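/- Let $R$ be a commutative Noetherian local ring with maximal ideal $\mathfrak m$ and residue field $k$, and suppose that $R$ is Cohen-Macaulay, i.e. $\operatorname{depth} R=\dim R$. Let $\omega$ be a canonical module of $R$, i.e. a finitely generated $R$-module such that $\dim_k \operatorname{Ext}^i_R(k,\omega)$ equals $1$ for $i=\dim R$ and $0$ for every other $i\ge 0$. For $n\ge 0$ let $\Omega_n^R(\omega)$ denote the $n$-th syzygy module of $\omega$, i.e. the image of the $n$-th differential of an augmented minimal free resolution $$\cdots\to F_2\to F_1\to F_0\to\omega\to 0$$ of $\omega$, where the $0$-th differential is the augmentation $F_0\to\omega$ (so $\Omega_0^R(\omega)=\omega$). Then, for any choice of the minimal free resolution, the following statements are equivalent: (i) $R$ is Gorenstein, i.e. $R$ has finite injective dimension as an $R$-module; (ii) $\Omega_n^R(\omega)$ has a non-zero free direct summand for some $n\ge 0$. -/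

import Mathlib

open CategoryTheory CategoryTheory.Abelian IsLocalRing

universe u

namespace LocalAlgebra

section Depth

variable (R : Type u) [CommRing R] [IsLocalRing R]

/-- The depth of a module `M` over a local ring `R`: the supremum of the lengths of the
`M`-regular sequences consisting of elements of the maximal ideal. -/
noncomputable def depth (M : Type u) [AddCommGroup M] [Module R M] : ℕ∞ :=
  ⨆ rs : {rs : List R // (∀ r ∈ rs, r ∈ maximalIdeal R) ∧ RingTheory.Sequence.IsRegular M rs},
    (rs.1.length : ℕ∞)

/-- A (Noetherian) local ring is Cohen-Macaulay if its depth equals its Krull dimension. -/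
def IsCohenMacaulay : Prop :=
  (depth R R : WithBot ℕ∞) = ringKrullDim R

end Depth

/-- A (Noetherian) local ring is Gorenstein if it has finite injective dimension as a module
over itself. -/
def IsGorenstein (R : Type u) [CommRing R] [IsLocalRing R] : Prop :=
  ∃ n : ℕ, HasInjectiveDimensionLE (ModuleCat.of R R) n

open Classical in
/-- A finitely generated module `ω` over a (Noetherian) local ring `(R, 𝔪, k)` is a canonical
module if `dim_k Ext^i_R(k, ω)` is `1` for `i = dim R` and `0` for every other `i`.
As `𝔪` annihilates `Ext^i_R(k, ω)`, its submodules over `R` are its `k`-subspaces, and its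
dimension over `k` is its length over `R`. -/
structure IsCanonicalModule (R : Type u) [CommRing R] [IsLocalRing R]
    (ω : Type u) [AddCommGroup ω] [Module R ω] : Prop where
  finite : Module.Finite R ω
  length_ext : ∀ i : ℕ,
    Module.length R (Ext (ModuleCat.of R (ResidueField R)) (ModuleCat.of R ω) i) =
      if (i : WithBot ℕ∞) = ringKrullDim R then 1 else 0

/-- An augmented minimal free resolution
`⋯ → R ^ rank 2 → R ^ rank 1 → R ^ rank 0 → M → 0` of a module `M` over a local ring `R`:
it is exact, and the image of each `d n` is contained in `𝔪 • R ^ rank n`. -/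
structure MinimalFreeResolution (R : Type u) [CommRing R] [IsLocalRing R]
    (M : Type u) [AddCommGroup M] [Module R M] where
  rank : ℕ → ℕ
  d : ∀ n : ℕ, (Fin (rank (n + 1)) → R) →ₗ[R] (Fin (rank n) → R)
  ε : (Fin (rank 0) → R) →ₗ[R] M
  surjective_ε : Function.Surjective ε
  exact_ε : Function.Exact (d 0) ε
  exact_d : ∀ n : ℕ, Function.Exact (d (n + 1)) (d n)
  minimal : ∀ n : ℕ,
    LinearMap.range (d n) ≤ maximalIdeal R • (⊤ : Submodule R (Fin (rank n) → R))

namespace MinimalFreeResolution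

variable {R : Type u} [CommRing R] [IsLocalRing R] {M : Type u} [AddCommGroup M] [Module R M]

/-- The `n`-th syzygy module `Ω_n(M)`: the image of the `n`-th differential of the augmented
resolution, the `0`-th differential being the augmentation (so that `Ω_0(M) = M`). -/
def syzygy (F : MinimalFreeResolution R M) : ℕ → ModuleCat.{u} R
  | 0 => ModuleCat.of R (LinearMap.range F.ε)
  | n + 1 => ModuleCat.of R (LinearMap.range (F.d n))

end MinimalFreeResolution

/-- The module `N` has a non-zero free direct summand. -/
def HasNonzeroFreeSummand (R : Type u) [CommRing R] (N : Type u) [AddCommGroup N] [Module R N] :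
    Prop :=
  ∃ P Q : Submodule R N, IsCompl P Q ∧ P ≠ ⊥ ∧ Module.Free R P

section Existence

variable (R : Type u) [CommRing R] [IsLocalRing R]

/-- Every finitely generated module over a local ring has a minimal free cover. -/
theorem exists_minimal_cover (M : Type u) [AddCommGroup M] [Module R M] [Module.Finite R M] :
    ∃ (b : ℕ) (f : (Fin b → R) →ₗ[R] M), Function.Surjective f ∧
      LinearMap.ker f ≤ maximalIdeal R • (⊤ : Submodule R (Fin b → R)) := by
  classical
  have hex : ∃ b : ℕ, ∃ f : (Fin b → R) →ₗ[R] M, Function.Surjective f :=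
    Module.Finite.exists_fin' R M
  obtain ⟨f, hf⟩ := Nat.find_spec hex
  have hmin := fun m (hm : m < Nat.find hex) => Nat.find_min hex hm
  generalize Nat.find hex = b at f hf hmin
  refine ⟨b, f, hf, ?_⟩
  intro x hx
  have hall : ∀ i, x i ∈ maximalIdeal R := by
    intro i
    by_contra hi
    have hu : IsUnit (x i) := by simpa [mem_maximalIdeal, mem_nonunits_iff] using hi
    obtain ⟨v, hv⟩ := hu.exists_left_inv
    cases b with
    | zero => exact i.elim0
    | succ c =>
      refine hmin c (Nat.lt_succ_self c)
        ⟨f ∘ₗ Fintype.linearCombination R (fun j => Pi.single (i.succAbove j) (1 : R)), ?_⟩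
      intro m
      obtain ⟨y, rfl⟩ := hf m
      refine ⟨fun j => (y - (y i * v) • x) (i.succAbove j), ?_⟩
      have h0 : f (y - (y i * v) • x) = f y := by
        have : f x = 0 := hx
        simp [this]
      rw [← h0, LinearMap.comp_apply]
      congr 1
      have hi0 : (y - (y i * v) • x) i = 0 := by
        simp [mul_assoc, hv]
      generalize y - (y i * v) • x = z at hi0
      conv_rhs => rw [pi_eq_sum_univ' z, Fin.sum_univ_succAbove _ i, hi0]
      simp only [Fintype.linearCombination_apply, zero_smul, zero_add]
  rw [pi_eq_sum_univ' x]
  exact Submodule.sum_mem _ fun i _ => Submodule.smul_mem_smul (hall i) trivial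

/-- Every finitely generated module over a Noetherian local ring has a minimal free resolution. -/
theorem nonempty_minimalFreeResolution [IsNoetherianRing R]
    (M : Type u) [AddCommGroup M] [Module R M] [Module.Finite R M] :
    Nonempty (MinimalFreeResolution R M) := by
  obtain ⟨b₀, ε, hε, hε'⟩ := exists_minimal_cover R M
  have step : ∀ s : (Σ b : ℕ, Submodule R (Fin b → R)),
      ∃ (c : ℕ) (g : (Fin c → R) →ₗ[R] (Fin s.1 → R)), LinearMap.range g = s.2 ∧
        LinearMap.ker g ≤ maximalIdeal R • (⊤ : Submodule R (Fin c → R)) := by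
    rintro ⟨b, K⟩
    obtain ⟨c, f, hf, hk⟩ := exists_minimal_cover R K
    refine ⟨c, K.subtype ∘ₗ f, ?_, ?_⟩
    · rw [LinearMap.range_comp, LinearMap.range_eq_top.mpr hf, Submodule.map_top,
        Submodule.range_subtype]
    · rwa [LinearMap.ker_comp_of_ker_eq_bot f K.ker_subtype]
  choose c g hg hk using step
  let s : ℕ → (Σ b : ℕ, Submodule R (Fin b → R)) := fun n =>
    Nat.rec ⟨b₀, LinearMap.ker ε⟩ (fun _ t => ⟨c t, LinearMap.ker (g t)⟩) n
  have hs : ∀ n, (s n).2 ≤ maximalIdeal R • (⊤ : Submodule R (Fin (s n).1 → R)) := by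
    intro n
    cases n with
    | zero => exact hε'
    | succ n => exact hk (s n)
  exact ⟨{
    rank := fun n => (s n).1
    d := fun n => g (s n)
    ε := ε
    surjective_ε := hε
    exact_ε := LinearMap.exact_iff.mpr (hg (s 0)).symm
    exact_d := fun n => LinearMap.exact_iff.mpr (hg (s (n + 1))).symm
    minimal := fun n => (hg (s n)).le.trans (hs n) }⟩

end Existence

end LocalAlgebra

/-! Put d = dim R. Since Ext^i(k, -) vanishes below d on both R and ω, there is one sequence `rs` of
length d in 𝔪 that is regular on both; reduction modulo `rs` replaces R by a zero-dimensional ring,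
and `exists_ext_class_comp_bijective` turns Ext^d into Hom.

If R is Gorenstein, then R ≅ ω, so n = 0 works (`nonempty_linearEquiv_of_isGorenstein`). Indeed ω/rs
has simple socle, an embedding of k in R/rs extends to an injection ω/rs → R/rs because Ext^{d+1}(-,
R) = 0, and this injection splits because Ext^{d+1}(-, ω) = 0. As R is local, the split injection is
bijective, and Nakayama lifts the isomorphism.

Conversely, a free summand of ω itself makes Ext^i(k, R) a retract of Ext^i(k, ω), which is zero for
i > d, and Bass's theorem bounds the injective dimension of R (`isGorenstein_of_retract`). For n ≥ 1
a free summand is impossible: a socle element of R/rs kills the syzygy modulo `rs`, by minimality,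
but does not kill R/rs (`not_hasNonzeroFreeSummand_of_le_smul_top`). -/

namespace LocalAlgebra
-- Regular sequences, zero-dimensional reduction and associated primes.
section Commutative
open RingTheory.Sequence

variable {R : Type u} [CommRing R] {L F M N : Type u} [AddCommGroup L] [Module R L]
  [AddCommGroup F] [Module R F] [AddCommGroup M] [Module R M] [AddCommGroup N] [Module R N]

/-- Regularity of `rs` on the cokernel M keeps L/rs L → F/rs F injective, so L ∩ rs F = rs L. -/
theorem mem_ofList_smul_top_of_exact {rs : List R} {f : L →ₗ[R] F} {g : F →ₗ[R] M}
    (hf : Function.Injective f) (hfg : Function.Exact f g) (hg : Function.Surjective g)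
    (h : IsWeaklyRegular M rs) {l : L}
    (hl : f l ∈ Ideal.ofList rs • (⊤ : Submodule R F)) :
    l ∈ Ideal.ofList rs • (⊤ : Submodule R L) := by
  -- Injectivity of `f` is encoded as exactness after a zero map, to fit the four-term exactness
  -- lemma.
  have h0 : Function.Exact (0 : PUnit.{u + 1} →ₗ[R] L) f :=
    (LinearMap.exact_zero_iff_injective _ _).mpr hf
  have key := map_first_exact_on_four_term_right_exact_of_isSMulRegular_last h0 hfg hg h
  have := (key (Submodule.Quotient.mk l)).mp (by
    rw [Submodule.mapQ_apply, Submodule.Quotient.mk_eq_zero]; exact hl)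
  obtain ⟨y, hy⟩ := this
  obtain ⟨y, rfl⟩ := Submodule.Quotient.mk_surjective _ y
  rw [Submodule.mapQ_apply, LinearMap.zero_apply, Submodule.Quotient.mk_zero] at hy
  exact (Submodule.Quotient.mk_eq_zero _).mp hy.symm

/-- Regularity of the first element on M keeps the sequence short exact after reduction modulo that
element, which allows induction on `rs`. -/
theorem isWeaklyRegular_of_exact {rs : List R} (f : L →ₗ[R] F) (g : F →ₗ[R] M)
    (hf : Function.Injective f) (hfg : Function.Exact f g) (hg : Function.Surjective g)
    (hF : IsWeaklyRegular F rs) (hM : IsWeaklyRegular M rs) : IsWeaklyRegular L rs := by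
  induction rs generalizing L F M with
  | nil => exact .nil R L
  | cons r rs ih =>
    rw [isWeaklyRegular_cons_iff] at hF hM ⊢
    refine ⟨hF.1.of_injective f hf, ih (QuotSMulTop.map r f) (QuotSMulTop.map r g) ?_
      (QuotSMulTop.map_exact r hfg hg) (QuotSMulTop.map_surjective r hg) hF.2 hM.2⟩
    have h0 : Function.Exact (0 : PUnit.{u + 1} →ₗ[R] L) f :=
      (LinearMap.exact_zero_iff_injective _ _).mpr hf
    have key := QuotSMulTop.map_first_exact_on_four_term_exact_of_isSMulRegular_last h0 hfg hM.1
    rw [map_zero] at key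
    exact (LinearMap.exact_zero_iff_injective _ _).mp key

theorem isWeaklyRegular_pi_fin {rs : List R} (h : IsWeaklyRegular R rs) (n : ℕ) :
    IsWeaklyRegular (Fin n → R) rs :=
  ((TensorProduct.lid R (Fin n → R)).isWeaklyRegular_congr rs).mp h.isWeaklyRegular_rTensor

theorem exists_apply_eq_one_of_hasNonzeroFreeSummand (h : HasNonzeroFreeSummand R N) :
    ∃ (e : N) (φ : N →ₗ[R] R), φ e = 1 := by
  obtain ⟨P, Q, hPQ, hP, _⟩ := h
  have : Nontrivial P := Submodule.nontrivial_iff_ne_bot.mpr hP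
  let b := Module.Free.chooseBasis R P
  obtain ⟨i⟩ := b.index_nonempty
  exact ⟨b i, b.coord i ∘ₗ P.projectionOnto Q hPQ, by simp⟩

variable [IsLocalRing R]

theorem exists_ringKrullDim_eq_and_isRegular [IsNoetherianRing R] (h : IsCohenMacaulay R) :
    ∃ (d : ℕ) (rs : List R), ringKrullDim R = d ∧ rs.length = d ∧
      (∀ r ∈ rs, r ∈ maximalIdeal R) ∧ IsRegular R rs := by
  obtain ⟨d, hd⟩ : ∃ d : ℕ, ringKrullDim R = d := by
    have h1 := ringKrullDim_ne_bot (R := R)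
    have h2 := ringKrullDim_ne_top (R := R)
    generalize ringKrullDim R = x at h1 h2
    induction x with
    | bot => exact absurd rfl h1
    | coe x =>
      induction x with
      | top => exact absurd rfl h2
      | coe n => exact ⟨n, rfl⟩
  rw [IsCohenMacaulay, hd] at h
  have h' : depth R R = (d : ℕ∞) := by exact_mod_cast h
  have : Nonempty {rs : List R // (∀ r ∈ rs, r ∈ maximalIdeal R) ∧ IsRegular R rs} :=
    ⟨⟨[], by simp, IsRegular.nil R R⟩⟩
  -- A finite supremum in `ℕ∞` is attained, so some regular sequence realizes the depth.
  obtain ⟨rs, hrs⟩ := ENat.exists_eq_iSup_of_lt_top (lt_of_eq_of_lt h' (ENat.natCast_lt_top d))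
  refine ⟨d, rs.1, hd, ?_, rs.2⟩
  have := hrs.trans h'
  exact_mod_cast this

theorem eq_maximalIdeal_of_ofList_le [IsNoetherianRing R] {rs : List R} (h : IsRegular R rs)
    (hd : ringKrullDim R = rs.length) {p : Ideal R} [p.IsPrime] (hp : Ideal.ofList rs ≤ p) :
    p = maximalIdeal R := by
  have h1 := ringKrullDim_add_length_eq_ringKrullDim_of_isRegular rs h
  have h2 : ringKrullDim (R ⧸ Ideal.ofList rs) = 0 := by
    rw [hd] at h1
    generalize ringKrullDim (R ⧸ Ideal.ofList rs) = x at h1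
    induction x with
    | bot => simp at h1
    | coe x =>
      induction x with
      | top => exact absurd h1 (by norm_cast; simp)
      | coe n =>
        have : n + rs.length = rs.length := by exact_mod_cast h1
        simp_all
  have : Ring.KrullDimLE 0 (R ⧸ Ideal.ofList rs) := by
    rw [Ring.krullDimLE_iff, h2]; simp
  have hq : (p.map (Ideal.Quotient.mk (Ideal.ofList rs))).IsPrime :=
    Ideal.map_isPrime_of_surjective Ideal.Quotient.mk_surjective (by simpa using hp)
  have hm : (p.map (Ideal.Quotient.mk (Ideal.ofList rs))).IsMaximal := inferInstance
  have := Ideal.comap_isMaximal_of_surjective (Ideal.Quotient.mk (Ideal.ofList rs))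
    Ideal.Quotient.mk_surjective (K := p.map (Ideal.Quotient.mk (Ideal.ofList rs)))
  rw [Ideal.comap_map_of_surjective _ Ideal.Quotient.mk_surjective, ← RingHom.ker_eq_comap_bot,
    Ideal.mk_ker, sup_eq_left.mpr hp] at this
  exact IsLocalRing.eq_maximalIdeal this

/-- An associated prime of N contains the annihilator, hence I, so it can only be 𝔪. -/
theorem exists_injective_residueField [IsNoetherianRing R] {I : Ideal R}
    (hI : ∀ p : Ideal R, p.IsPrime → I ≤ p → p = maximalIdeal R) [Nontrivial N]
    (hN : I ≤ Module.annihilator R N) :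
    ∃ f : ResidueField R →ₗ[R] N, Function.Injective f := by
  obtain ⟨p, hp⟩ := associatedPrimes.nonempty R N
  have hp' := hI p hp.isPrime
    (hN.trans (Submodule.annihilator_top.symm.le.trans hp.annihilator_le))
  subst hp'
  obtain ⟨f, hf⟩ := (isAssociatedPrime_iff_exists_injective_linearMap _ _).mp hp |>.2
  exact ⟨f, hf⟩

end Commutative
-- Ext and dimension shifting along a regular sequence.
section Extensions
open RingTheory.Sequence

variable {R : Type u} [CommRing R]

theorem ext_smul_eq_zero {M N : ModuleCat.{u} R} {i : ℕ} (x : Ext M N i) {r : R}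
    (hr : r ∈ Module.annihilator R M) : r • x = 0 := by
  have h : r • 𝟙 M = 0 := by
    ext m
    exact Module.mem_annihilator.mp hr m
  have : r • x = (Ext.mk₀ (r • 𝟙 M)).comp x (zero_add i) := by
    rw [Ext.mk₀_smul, Ext.smul_comp, Ext.mk₀_id_comp]
  rw [this, h, Ext.mk₀_zero, Ext.zero_comp]

/-- The consequences of the long exact sequences of `Ext` attached to multiplication by a regular
element `r` on `N`, with connecting class `δ`. -/
theorem exists_ext_class_of_isSMulRegular {N : ModuleCat.{u} R} {r : R} (hr : IsSMulRegular N r) :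
    ∃ δ : Ext (ModuleCat.of R (QuotSMulTop r N)) N 1,
      (∀ (M : ModuleCat.{u} R) (i : ℕ) (x : Ext M N (i + 1)), r • x = 0 →
        ∃ y : Ext M (ModuleCat.of R (QuotSMulTop r N)) i, y.comp δ rfl = x) ∧
      (∀ (M : ModuleCat.{u} R) (i : ℕ) (y : Ext M (ModuleCat.of R (QuotSMulTop r N)) i),
        (∀ z : Ext M N i, z = 0) → y.comp δ rfl = 0 → y = 0) ∧
      (∀ (Y : ModuleCat.{u} R) (i : ℕ) (x : Ext N Y i),
        (∀ z : Ext (ModuleCat.of R (QuotSMulTop r N)) Y (i + 1), z = 0) →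
        ∃ y : Ext N Y i, r • y = x) := by
  have hS := hr.smulShortComplex_shortExact
  refine ⟨hS.extClass, fun M i x hx => ?_, fun M i y hz hy => ?_, fun Y i x hz => ?_⟩
  · refine Ext.covariant_sequence_exact₁ M hS x ?_ rfl
    have h : x.comp (Ext.mk₀ (r • 𝟙 N)) (add_zero (i + 1)) = r • x := by
      rw [Ext.mk₀_smul, Ext.comp_smul, Ext.comp_mk₀_id]
    exact h.trans hx
  · obtain ⟨z, rfl⟩ := Ext.covariant_sequence_exact₃ M hS y rfl hy
    have h (w : Ext M N i) (hw : w = 0) :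
        w.comp (Ext.mk₀ (show N ⟶ ModuleCat.of R (QuotSMulTop r N) from
          (N.smulShortComplex r).g)) (add_zero i) = 0 := by rw [hw, Ext.zero_comp]
    exact h z (hz z)
  · obtain ⟨y, hy⟩ := Ext.contravariant_sequence_exact₁ hS Y x (add_comm 1 i) (hz _)
    have h (w : Ext N Y i) : (Ext.mk₀ (r • 𝟙 N)).comp w (zero_add i) = r • w := by
      rw [Ext.mk₀_smul, Ext.smul_comp, Ext.mk₀_id_comp]
    exact ⟨y, (h y).symm.trans hy⟩

theorem ext_comp_mk₀_iso_bijective {A B : ModuleCat.{u} R} (M : ModuleCat.{u} R) (e : A ≅ B)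
    (i : ℕ) : Function.Bijective fun f : Ext M A i => f.comp (Ext.mk₀ e.hom) (add_zero i) := by
  refine ⟨fun f g hfg => ?_, fun g => ⟨g.comp (Ext.mk₀ e.inv) (add_zero i), ?_⟩⟩
  · have := congrArg (fun t => t.comp (Ext.mk₀ e.inv) (add_zero i)) hfg
    simpa only [Ext.comp_assoc_of_third_deg_zero, Ext.mk₀_comp_mk₀, Iso.hom_inv_id,
      Ext.comp_mk₀_id] using this
  · simp only [Ext.comp_assoc_of_third_deg_zero, Ext.mk₀_comp_mk₀, Iso.inv_hom_id,
      Ext.comp_mk₀_id]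

theorem hom_ext_eq_zero_of_smul_eq_zero {M N : ModuleCat.{u} R} {r : R} (hr : IsSMulRegular N r)
    (x : Ext M N 0) (hx : r • x = 0) : x = 0 := by
  obtain ⟨f, rfl⟩ := (Ext.mk₀_bijective _ _).2 x
  rw [← Ext.mk₀_smul, Ext.mk₀_eq_zero_iff] at hx
  rw [Ext.mk₀_eq_zero_iff]
  ext m
  have := congrArg (fun g : M ⟶ N => g.hom m) hx
  exact hr.right_eq_zero_of_smul this

/-- A class killed by the first element `r` comes from Ext(M, N/rN) one degree lower, where
induction applies. -/
theorem ext_eq_zero_of_isWeaklyRegular {rs : List R} {M N : ModuleCat.{u} R}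
    (hM : ∀ r ∈ rs, r ∈ Module.annihilator R M) (hN : IsWeaklyRegular N rs) {i : ℕ}
    (hi : i < rs.length) (x : Ext M N i) : x = 0 := by
  induction rs generalizing N i with
  | nil => simp at hi
  | cons r rs ih =>
    rw [isWeaklyRegular_cons_iff] at hN
    have h0 : r • x = 0 := ext_smul_eq_zero x (hM r (by simp))
    cases i with
    | zero => exact hom_ext_eq_zero_of_smul_eq_zero hN.1 x h0
    | succ j =>
      obtain ⟨δ, h1, -⟩ := exists_ext_class_of_isSMulRegular hN.1
      obtain ⟨y, rfl⟩ := h1 M j x h0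
      rw [ih (N := ModuleCat.of R (QuotSMulTop r N)) (fun s hs => hM s (by simp [hs])) hN.2
        (by simpa using hi) y, Ext.zero_comp]

/-- Dimension shifting along a regular sequence: for modules `M` killed by `rs`, composition with
a fixed class identifies `Hom(M, N / rs N)` with `Ext(M, N)` in degree the length of `rs`. -/
theorem exists_ext_class_comp_bijective {rs : List R} {N : ModuleCat.{u} R}
    (hN : IsWeaklyRegular N rs) :
    ∃ δ : Ext (ModuleCat.of R (N ⧸ Ideal.ofList rs • (⊤ : Submodule R N))) N rs.length,
      ∀ M : ModuleCat.{u} R, (∀ r ∈ rs, r ∈ Module.annihilator R M) →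
        Function.Bijective fun f : Ext M _ 0 => f.comp δ (zero_add rs.length) := by
  induction rs generalizing N with
  | nil =>
    let e : (N ⧸ Ideal.ofList ([] : List R) • (⊤ : Submodule R N)) ≃ₗ[R] N :=
      Submodule.quotEquivOfEqBot _ (by simp)
    exact ⟨Ext.mk₀ e.toModuleIso.hom, fun M _ => ext_comp_mk₀_iso_bijective M e.toModuleIso 0⟩
  | cons r rs ih =>
    have hN' := hN
    rw [isWeaklyRegular_cons_iff] at hN
    obtain ⟨δ₁, h₁, h₂, -⟩ := exists_ext_class_of_isSMulRegular hN.1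
    obtain ⟨δ, hδ⟩ := ih (N := ModuleCat.of R (QuotSMulTop r N)) hN.2
    let e := (Submodule.quotOfListConsSMulTopEquivQuotSMulTopInner N r rs).toModuleIso
    refine ⟨(Ext.mk₀ e.hom).comp (δ.comp δ₁ rfl) (zero_add _), fun M hM => ?_⟩
    -- Injectivity needs Ext(M, N) = 0 in degree `rs.length`, which holds because `r :: rs` is one
    -- longer; surjectivity holds because `r` kills Ext.
    have h3 : Function.Bijective fun f : Ext M (ModuleCat.of R (QuotSMulTop r N)) rs.length =>
        f.comp δ₁ (rfl : rs.length + 1 = rs.length + 1) := by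
      constructor
      · intro f g hfg
        rw [← sub_eq_zero]
        refine h₂ M _ _ (ext_eq_zero_of_isWeaklyRegular hM hN' (by simp)) ?_
        rw [sub_eq_add_neg, Ext.add_comp, Ext.neg_comp, ← sub_eq_add_neg, sub_eq_zero]
        exact hfg
      · exact fun x => h₁ M _ x (ext_smul_eq_zero x (hM r (by simp)))
    have h2 := hδ M fun s hs => hM s (by simp [hs])
    have h := h3.comp (h2.comp (ext_comp_mk₀_iso_bijective M e 0))
    refine (congrArg Function.Bijective (funext fun f => ?_)).mp h
    exact (Ext.comp_assoc (f.comp (Ext.mk₀ e.hom) (add_zero 0)) δ δ₁ (zero_add _) rfl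
      (by omega)).trans (Ext.comp_assoc_of_second_deg_zero ..)

/-- Linear maps into `N / rs N` from a submodule of a module killed by `rs` extend if the
relevant `Ext` group vanishes. -/
theorem exists_extension_of_ext_eq_zero {rs : List R} {N : ModuleCat.{u} R}
    (hN : IsWeaklyRegular N rs) {L M : Type u} [AddCommGroup L] [Module R L] [AddCommGroup M]
    [Module R M] (hM : ∀ r ∈ rs, r ∈ Module.annihilator R M) (j : L →ₗ[R] M)
    (hj : Function.Injective j)
    (h : ∀ x : Ext (ModuleCat.of R (M ⧸ LinearMap.range j)) N (rs.length + 1), x = 0)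
    (f : L →ₗ[R] N ⧸ Ideal.ofList rs • (⊤ : Submodule R N)) :
    ∃ g : M →ₗ[R] N ⧸ Ideal.ofList rs • (⊤ : Submodule R N), g ∘ₗ j = f := by
  obtain ⟨δ, hδ⟩ := exists_ext_class_comp_bijective hN
  have hL : ∀ r ∈ rs, r ∈ Module.annihilator R L := fun r hr =>
    LinearMap.annihilator_le_of_injective j hj (hM r hr)
  let S : ShortComplex (ModuleCat.{u} R) :=
    ModuleCat.shortComplexOfCompEqZero j (LinearMap.range j).mkQ
      (LinearMap.exact_map_mkQ_range j).linearMap_comp_eq_zero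
  have hS : S.ShortExact := ModuleCat.shortComplex_shortExact S
    (LinearMap.exact_map_mkQ_range j) hj (Submodule.mkQ_surjective _)
  -- The obstruction to extending the class of `f` from L to M lies in the vanishing group; the
  -- bijections given by `δ` then turn the extended class back into a map.
  obtain ⟨y, hy⟩ := Ext.contravariant_sequence_exact₁ hS N
    ((Ext.mk₀ (ModuleCat.ofHom f)).comp δ (zero_add _)) (add_comm _ _) (h _)
  obtain ⟨g, rfl⟩ := (hδ (ModuleCat.of R M) hM).2 y
  obtain ⟨g, rfl⟩ := (Ext.mk₀_bijective _ _).2 g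
  refine ⟨g.hom, ?_⟩
  have h1 := (hδ (ModuleCat.of R L) hL).1 (a₁ := Ext.mk₀ (ModuleCat.ofHom j ≫ g))
    (a₂ := Ext.mk₀ (ModuleCat.ofHom f)) (by
      simp only
      rw [← hy, ← Ext.mk₀_comp_mk₀_assoc])
  have h2 := (Ext.mk₀_bijective _ _).1 h1
  exact congrArg ModuleCat.Hom.hom h2

end Extensions
-- Bass's criterion for injective dimension, and common regular sequences.
section InjectiveDimension
open RingTheory.Sequence

variable {R : Type u} [CommRing R]

theorem ext_eq_zero_of_linearEquiv {M M' : Type u} [AddCommGroup M] [Module R M] [AddCommGroup M']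
    [Module R M'] (e : M ≃ₗ[R] M') {N : ModuleCat.{u} R} {i : ℕ}
    (h : ∀ x : Ext (ModuleCat.of R M') N i, x = 0) (x : Ext (ModuleCat.of R M) N i) : x = 0 := by
  have h1 : (Ext.mk₀ e.toModuleIso.hom).comp
      ((Ext.mk₀ e.toModuleIso.inv).comp x (zero_add i)) (zero_add i) = x := by
    rw [← Ext.comp_assoc_of_second_deg_zero, Ext.mk₀_comp_mk₀, Iso.hom_inv_id, Ext.mk₀_id_comp]
  rw [← h1, h ((Ext.mk₀ e.toModuleIso.inv).comp x (zero_add i)), Ext.comp_zero]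

theorem ext_eq_zero_of_exact {M₁ M₂ M₃ : Type u} [AddCommGroup M₁] [Module R M₁]
    [AddCommGroup M₂] [Module R M₂] [AddCommGroup M₃] [Module R M₃] {f : M₁ →ₗ[R] M₂}
    {g : M₂ →ₗ[R] M₃} (hf : Function.Injective f) (hg : Function.Surjective g)
    (hfg : Function.Exact f g) {N : ModuleCat.{u} R} {i : ℕ}
    (h₁ : ∀ x : Ext (ModuleCat.of R M₁) N i, x = 0) (h₃ : ∀ x : Ext (ModuleCat.of R M₃) N i, x = 0)
    (x : Ext (ModuleCat.of R M₂) N i) : x = 0 := by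
  let S : ShortComplex (ModuleCat.{u} R) :=
    ModuleCat.shortComplexOfCompEqZero f g hfg.linearMap_comp_eq_zero
  have hS : S.ShortExact := ModuleCat.shortComplex_shortExact S hfg hf hg
  obtain ⟨y, rfl⟩ := Ext.contravariant_sequence_exact₂ hS N x (h₁ _)
  rw [h₃ y, Ext.comp_zero]

theorem ext_eq_zero_of_injective {L M : Type u} [AddCommGroup L] [Module R L]
    [AddCommGroup M] [Module R M] {f : L →ₗ[R] M} (hf : Function.Injective f)
    {N : ModuleCat.{u} R} {i : ℕ} (hM : ∀ x : Ext (ModuleCat.of R M) N i, x = 0)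
    (hQ : ∀ x : Ext (ModuleCat.of R (M ⧸ LinearMap.range f)) N (i + 1), x = 0)
    (x : Ext (ModuleCat.of R L) N i) : x = 0 := by
  let S : ShortComplex (ModuleCat.{u} R) :=
    ModuleCat.shortComplexOfCompEqZero f (LinearMap.range f).mkQ
      (LinearMap.exact_map_mkQ_range f).linearMap_comp_eq_zero
  have hS : S.ShortExact := ModuleCat.shortComplex_shortExact S
    (LinearMap.exact_map_mkQ_range f) hf (Submodule.mkQ_surjective _)
  obtain ⟨y, rfl⟩ := Ext.contravariant_sequence_exact₁ hS N x (add_comm 1 i) (hQ _)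
  rw [hM y, Ext.comp_zero]

theorem injective_of_ext_one_eq_zero {N : ModuleCat.{u} R}
    (h : ∀ (I : Ideal R) (x : Ext (ModuleCat.of R (R ⧸ I)) N 1), x = 0) : Injective N := by
  rw [← Module.injective_iff_injective_object, ← Module.Baer.iff_injective]
  intro I g
  let S : ShortComplex (ModuleCat.{u} R) :=
    ModuleCat.shortComplexOfCompEqZero I.subtype I.mkQ
      (LinearMap.exact_subtype_mkQ I).linearMap_comp_eq_zero
  have hS : S.ShortExact := ModuleCat.shortComplex_shortExact S
    (LinearMap.exact_subtype_mkQ I) I.injective_subtype (Submodule.mkQ_surjective _)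
  obtain ⟨y, hy⟩ := Ext.contravariant_sequence_exact₁ hS N
    (Ext.mk₀ (ModuleCat.ofHom g)) (add_zero 1) (h I _)
  obtain ⟨y, rfl⟩ := (Ext.mk₀_bijective _ _).2 y
  rw [Ext.mk₀_comp_mk₀] at hy
  have := (Ext.mk₀_bijective _ _).1 hy
  exact ⟨y.hom, fun x hx => congrArg (fun t => t.hom (⟨x, hx⟩ : I)) this⟩

/-- Passing to the cokernel of an embedding in an injective lowers the degree by one; the base case
is Baer's criterion. -/
theorem hasInjectiveDimensionLE_of_ext_eq_zero (d : ℕ) (N : ModuleCat.{u} R)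
    (h : ∀ (I : Ideal R) (x : Ext (ModuleCat.of R (R ⧸ I)) N (d + 1)), x = 0) :
    HasInjectiveDimensionLE N d := by
  induction d generalizing N with
  | zero =>
    have := injective_of_ext_one_eq_zero h
    change HasInjectiveDimensionLT N 1
    infer_instance
  | succ d ih =>
    obtain ⟨J, _, f, _⟩ := EnoughInjectives.presentation N
    let S : ShortComplex (ModuleCat.{u} R) :=
      ModuleCat.shortComplexOfCompEqZero f.hom _ f.hom.exact_map_mkQ_range.linearMap_comp_eq_zero
    have hS : S.ShortExact := ModuleCat.shortComplex_shortExact S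
      f.hom.exact_map_mkQ_range ((ModuleCat.mono_iff_injective f).mp ‹_›)
      (Submodule.mkQ_surjective _)
    have hJ : Injective S.X₂ := ‹Injective J›
    refine (hS.hasInjectiveDimensionLT_X₃_iff d hJ).mp (ih S.X₃ fun I x => ?_)
    obtain ⟨y, rfl⟩ := Ext.covariant_sequence_exact₃ _ hS x rfl (h I _)
    rw [Ext.eq_zero_of_injective y, Ext.zero_comp]

variable [IsLocalRing R] [IsNoetherianRing R]

/-- Bass: if `Ext^i(k, N)` vanishes in all degrees above `d`, then so does `Ext^i(M, N)` for all
finitely generated `M`. -/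
theorem ext_eq_zero_of_residueField {N : ModuleCat.{u} R} [Module.Finite R N] {d : ℕ}
    (h : ∀ i, d < i → ∀ x : Ext (ModuleCat.of R (ResidueField R)) N i, x = 0)
    (M : Type u) [AddCommGroup M] [Module R M] [Module.Finite R M] {i : ℕ} (hi : d < i)
    (x : Ext (ModuleCat.of R M) N i) : x = 0 := by
  -- Noetherian induction on an ideal killing M: the claim is assumed for modules killed by a
  -- strictly larger ideal. A prime filtration reduces it to M = R/p.
  suffices H : ∀ (I : Ideal R) (M : Type u) [AddCommGroup M] [Module R M] [Module.Finite R M],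
      I ≤ Module.annihilator R M → ∀ i, d < i → ∀ x : Ext (ModuleCat.of R M) N i, x = 0 from
    H ⊥ M bot_le i hi x
  intro I
  induction I using WellFoundedGT.induction with
  | ind I ih =>
  intro M _ _ hM
  induction hM using IsNoetherianRing.induction_on_isQuotientEquivQuotientPrime R with
  | subsingleton M =>
    intro _ i _ x
    have h1 : (1 : R) • x = 0 :=
      ext_smul_eq_zero x (by simp [Module.mem_annihilator, eq_iff_true_of_subsingleton])
    rwa [one_smul] at h1
  | quotient M p e =>
    intro hI i hi
    refine ext_eq_zero_of_linearEquiv e ?_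
    rw [e.annihilator_eq, Ideal.annihilator_quotient] at hI
    rcases hI.lt_or_eq with hlt | rfl
    · exact ih p.1 hlt _ (Ideal.annihilator_quotient).ge i hi
    by_cases hp : p.1 = maximalIdeal R
    · rw [hp]
      exact h i hi
    obtain ⟨x, hx, hxp⟩ := SetLike.exists_of_lt
      (lt_of_le_of_ne (IsLocalRing.le_maximalIdeal p.2.ne_top) hp)
    have hreg : IsSMulRegular (R ⧸ p.1) x := by
      have : p.1.IsPrime := p.2
      rw [isSMulRegular_iff_right_eq_zero_of_smul]
      intro m hm
      obtain ⟨m, rfl⟩ := Ideal.Quotient.mk_surjective m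
      have : Ideal.Quotient.mk p.1 (x * m) = 0 := hm
      rw [Ideal.Quotient.eq_zero_iff_mem] at this ⊢
      exact (p.2.mem_or_mem this).resolve_left hxp
    obtain ⟨-, -, -, h3⟩ := exists_ext_class_of_isSMulRegular (N := ModuleCat.of R (R ⧸ p.1)) hreg
    -- The module R/(p + (x)) is covered by induction, so its Ext^{i+1} vanishes and multiplication
    -- by x ∈ 𝔪 is onto on Ext^i(R/p, N). This Ext is finitely generated, so Nakayama kills it.
    have hsurj := fun y : Ext (ModuleCat.of R (R ⧸ p.1)) N i => h3 N i y
      (ih (p.1 ⊔ Ideal.span {x}) (lt_of_le_of_ne le_sup_left fun heq => hxp (heq ▸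
        Ideal.mem_sup_right (Ideal.mem_span_singleton_self x))) _ (sup_le
          ((Ideal.annihilator_quotient).ge.trans (LinearMap.annihilator_le_of_surjective _
            (Submodule.mkQ_surjective _)))
          ((Ideal.span_singleton_le_iff_mem _).mpr (QuotSMulTop.mem_annihilator _ x)))
        (i + 1) (by omega))
    have htop : (⊤ : Submodule R (Ext (ModuleCat.of R (R ⧸ p.1)) N i)) ≤
        maximalIdeal R • ⊤ := by
      intro y _
      obtain ⟨z, rfl⟩ := hsurj y
      exact Submodule.smul_mem_smul hx trivial
    have := Submodule.eq_bot_of_le_smul_of_le_jacobson_bot _ _ Module.Finite.fg_top htop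
      (IsLocalRing.maximalIdeal_le_jacobson _)
    exact fun y => (Submodule.mem_bot R).mp (this ▸ trivial)
  | exact M₁ M₂ M₃ f g hf hg hfg h₁ h₃ =>
    intro hI i hi
    exact ext_eq_zero_of_exact hf hg hfg
      (h₁ (hI.trans (LinearMap.annihilator_le_of_injective f hf)) i hi)
      (h₃ (hI.trans (LinearMap.annihilator_le_of_surjective g hg)) i hi)

theorem exists_isSMulRegular_of_hom_residueField {N : Type u} [AddCommGroup N] [Module R N]
    [Module.Finite R N] (h : ∀ f : ResidueField R →ₗ[R] N, f = 0) :
    ∃ r ∈ maximalIdeal R, IsSMulRegular N r := by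
  have : Subsingleton (ResidueField R →ₗ[R] N) := ⟨fun f g => by rw [h f, h g]⟩
  obtain ⟨r, hr, hr'⟩ := IsSMulRegular.subsingleton_linearMap_iff.mp this
  refine ⟨r, ?_, hr'⟩
  rwa [show Module.annihilator R (ResidueField R) = maximalIdeal R from
    Ideal.annihilator_quotient] at hr

/-- Vanishing of `Ext(k, -)` below `n` yields a common regular sequence of length `n`. -/
theorem exists_isWeaklyRegular_of_ext_eq_zero (n : ℕ) (M N : ModuleCat.{u} R) [Module.Finite R M]
    [Module.Finite R N]
    (hM : ∀ i < n, ∀ x : Ext (ModuleCat.of R (ResidueField R)) M i, x = 0)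
    (hN : ∀ i < n, ∀ x : Ext (ModuleCat.of R (ResidueField R)) N i, x = 0) :
    ∃ rs : List R, rs.length = n ∧ (∀ r ∈ rs, r ∈ maximalIdeal R) ∧ IsWeaklyRegular M rs ∧
      IsWeaklyRegular N rs := by
  induction n generalizing M N with
  | zero => exact ⟨[], rfl, by simp, .nil R M, .nil R N⟩
  | succ n ih =>
    have hom {K : ModuleCat.{u} R}
        (hK : ∀ i < n + 1, ∀ x : Ext (ModuleCat.of R (ResidueField R)) K i, x = 0)
        (f : ResidueField R →ₗ[R] K) : f = 0 := by
      have := hK 0 (by omega) (Ext.mk₀ (ModuleCat.ofHom f))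
      rw [Ext.mk₀_eq_zero_iff] at this
      exact congrArg ModuleCat.Hom.hom this
    -- Working with M × N gives one element regular on both modules.
    obtain ⟨r, hr, hreg⟩ := exists_isSMulRegular_of_hom_residueField (R := R) (N := M × N)
      fun f => by
        ext x
        · exact congrArg (fun g : ResidueField R →ₗ[R] M => g x)
            (hom hM (LinearMap.fst R M N ∘ₗ f))
        · exact congrArg (fun g : ResidueField R →ₗ[R] N => g x)
            (hom hN (LinearMap.snd R M N ∘ₗ f))
    have hrM : IsSMulRegular M r := hreg.of_injective (LinearMap.inl R M N) LinearMap.inl_injective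
    have hrN : IsSMulRegular N r := hreg.of_injective (LinearMap.inr R M N) LinearMap.inr_injective
    have step {K : ModuleCat.{u} R} (hrK : IsSMulRegular K r)
        (hK : ∀ i < n + 1, ∀ x : Ext (ModuleCat.of R (ResidueField R)) K i, x = 0) :
        ∀ i < n, ∀ x : Ext (ModuleCat.of R (ResidueField R))
          (ModuleCat.of R (QuotSMulTop r K)) i, x = 0 := by
      intro i hi x
      obtain ⟨δ, -, h2, -⟩ := exists_ext_class_of_isSMulRegular hrK
      exact h2 _ i x (hK i (by omega)) (hK (i + 1) (by omega) _)
    obtain ⟨rs, hl, hrs, h1, h2⟩ := ih (ModuleCat.of R (QuotSMulTop r M))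
      (ModuleCat.of R (QuotSMulTop r N)) (step hrM hM) (step hrN hN)
    exact ⟨r :: rs, by simp [hl], List.forall_mem_cons.mpr ⟨hr, hrs⟩, .cons hrM h1, .cons hrN h2⟩

end InjectiveDimension
-- Canonical modules and Ext over Gorenstein rings.
section Gorenstein
open RingTheory.Sequence

variable {R : Type u} [CommRing R]

theorem mem_annihilator_quotient_ofList_smul_top {rs : List R} (N : Type u) [AddCommGroup N]
    [Module R N] {r : R} (hr : r ∈ Ideal.ofList rs) :
    r ∈ Module.annihilator R (N ⧸ Ideal.ofList rs • (⊤ : Submodule R N)) := by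
  rw [Module.mem_annihilator]
  intro m
  obtain ⟨m, rfl⟩ := Submodule.Quotient.mk_surjective _ m
  rw [← Submodule.Quotient.mk_smul, Submodule.Quotient.mk_eq_zero]
  exact Submodule.smul_mem_smul hr trivial

variable [IsLocalRing R]

theorem ofList_le_maximalIdeal {rs : List R} (h : ∀ r ∈ rs, r ∈ maximalIdeal R) :
    Ideal.ofList rs ≤ maximalIdeal R :=
  Ideal.span_le.mpr h

theorem nontrivial_quotient_ofList_smul_top {rs : List R} (h : ∀ r ∈ rs, r ∈ maximalIdeal R)
    (N : Type u) [AddCommGroup N] [Module R N] [Module.Finite R N] [Nontrivial N] :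
    Nontrivial (N ⧸ Ideal.ofList rs • (⊤ : Submodule R N)) := by
  rw [Submodule.Quotient.nontrivial_iff]
  intro htop
  have := Submodule.eq_bot_of_le_smul_of_le_jacobson_bot _ _ Module.Finite.fg_top htop.ge
    ((ofList_le_maximalIdeal h).trans (IsLocalRing.maximalIdeal_le_jacobson _))
  exact top_ne_bot this

theorem isSimpleModule_residueField : IsSimpleModule R (ResidueField R) :=
  (isSimpleModule_iff_isCoatom).mpr (maximalIdeal.isMaximal R).out

namespace IsCanonicalModule

variable {ω : Type u} [AddCommGroup ω] [Module R ω] (h : IsCanonicalModule R ω) {d : ℕ}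
  (hd : ringKrullDim R = d)
include h hd

theorem ext_eq_zero {i : ℕ} (hi : i ≠ d)
    (x : Ext (ModuleCat.of R (ResidueField R)) (ModuleCat.of R ω) i) : x = 0 := by
  have h1 := h.length_ext i
  rw [if_neg (by rw [hd]; exact_mod_cast hi), Module.length_eq_zero_iff] at h1
  exact Subsingleton.elim _ _

theorem isSimpleModule_ext :
    IsSimpleModule R (Ext (ModuleCat.of R (ResidueField R)) (ModuleCat.of R ω) d) := by
  have h1 := h.length_ext d
  rwa [if_pos (by rw [hd]), Module.length_eq_one_iff] at h1

variable {rs : List R} (hrs : ∀ r ∈ rs, r ∈ maximalIdeal R) (hl : rs.length = d)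
  (hω : IsWeaklyRegular ω rs)
include hrs hl hω

/-- Modulo a maximal regular sequence, a canonical module has a simple socle. -/
theorem exists_socle_generator :
    ∃ j : ResidueField R →ₗ[R] ω ⧸ Ideal.ofList rs • (⊤ : Submodule R ω), j ≠ 0 ∧
      ∀ f, f ≠ 0 → ∃ r : R, r • f = j := by
  subst hl
  have hs := h.isSimpleModule_ext hd
  obtain ⟨δ, hδ⟩ := exists_ext_class_comp_bijective (N := ModuleCat.of R ω) hω
  replace hδ := hδ (ModuleCat.of R (ResidueField R)) fun r hr => by
    rw [show Module.annihilator R (ResidueField R) = maximalIdeal R from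
      Ideal.annihilator_quotient]
    exact hrs r hr
  have := IsSimpleModule.nontrivial R
    (Ext (ModuleCat.of R (ResidueField R)) (ModuleCat.of R ω) rs.length)
  obtain ⟨x, hx⟩ := exists_ne
    (0 : Ext (ModuleCat.of R (ResidueField R)) (ModuleCat.of R ω) rs.length)
  obtain ⟨j, rfl⟩ := hδ.2 x
  obtain ⟨j, rfl⟩ := (Ext.mk₀_bijective _ _).2 j
  refine ⟨j.hom, ?_, fun f hf => ?_⟩
  · intro hj
    refine hx ?_
    have : j = 0 := ModuleCat.hom_ext hj
    simp only [this, Ext.mk₀_zero, Ext.zero_comp]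
  -- The map `f` corresponds to a nonzero element of the simple module Ext^d(k, ω), and such an
  -- element generates it.
  · have hne : (Ext.mk₀ (ModuleCat.ofHom f)).comp δ (zero_add rs.length) ≠ 0 := by
      intro h0
      refine hf ?_
      have h1 := hδ.1 (a₁ := Ext.mk₀ (ModuleCat.ofHom f)) (a₂ := 0) (by
        simp only [h0, Ext.zero_comp])
      exact congrArg ModuleCat.Hom.hom ((Ext.mk₀_eq_zero_iff _).mp h1)
    obtain ⟨r, hr⟩ := (IsSimpleModule.toSpanSingleton_surjective R hne)
      ((Ext.mk₀ j).comp δ (zero_add rs.length))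
    refine ⟨r, ?_⟩
    have h1 := hδ.1 (a₁ := Ext.mk₀ (r • ModuleCat.ofHom f)) (a₂ := Ext.mk₀ j) (by
      simp only [Ext.mk₀_smul, Ext.smul_comp]
      exact hr)
    exact congrArg ModuleCat.Hom.hom ((Ext.mk₀_bijective _ _).1 h1)

end IsCanonicalModule

variable [IsNoetherianRing R]

/-- The quotient R/rs has projective dimension at most the length of `rs`. -/
theorem ext_quotient_ofList_eq_zero {rs : List R} (hrs : ∀ r ∈ rs, r ∈ maximalIdeal R)
    (hR : IsWeaklyRegular R rs) (N : ModuleCat.{u} R) {i : ℕ} (hi : rs.length < i)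
    (x : Ext (ModuleCat.of R (R ⧸ Ideal.ofList rs • (⊤ : Submodule R R))) N i) : x = 0 := by
  have h := ModuleCat.projectiveDimension_quotient_eq_add_length_of_isWeaklyRegular
    (ModuleCat.of R R) rs hR hrs
  have h0 : projectiveDimension (ModuleCat.of R R) ≤ (0 : ℕ) := by
    rw [projectiveDimension_le_iff]
    have : Projective (ModuleCat.of R R) := inferInstance
    change HasProjectiveDimensionLT (ModuleCat.of R R) 1
    infer_instance
  have h1 : projectiveDimension (ModuleCat.of R (R ⧸ Ideal.ofList rs • (⊤ : Submodule R R))) ≤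
      rs.length := by
    refine h.le.trans ?_
    calc _ ≤ ((0 : ℕ) : WithBot ℕ∞) + rs.length := by gcongr
      _ = rs.length := by simp
  rw [projectiveDimension_le_iff] at h1
  exact Ext.eq_zero_of_hasProjectiveDimensionLT x (rs.length + 1) hi

/-- Over a local ring `R` of finite injective dimension, `Ext(M, R)` vanishes above the length of a
maximal regular sequence for all finitely generated `M`. -/
theorem IsGorenstein.ext_eq_zero (hG : IsGorenstein R) {rs : List R} (hR : IsWeaklyRegular R rs)
    (hrs : ∀ r ∈ rs, r ∈ maximalIdeal R)
    (hp : ∀ p : Ideal R, p.IsPrime → Ideal.ofList rs ≤ p → p = maximalIdeal R)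
    (M : Type u) [AddCommGroup M] [Module R M] [Module.Finite R M] {i : ℕ} (hi : rs.length < i)
    (x : Ext (ModuleCat.of R M) (ModuleCat.of R R) i) : x = 0 := by
  obtain ⟨n, hn⟩ := hG
  -- The vanishing bound is lowered one degree at a time. Embed k in R/rs: Ext^i(R/rs, R) vanishes
  -- by projective dimension and Ext^{i+1} of the cokernel by the current bound, so Ext^i(k, R) = 0,
  -- and Bass passes this to all M.
  suffices H : ∀ j : ℕ, (∀ i, rs.length + j < i → ∀ (M : Type u) [AddCommGroup M] [Module R M]
      [Module.Finite R M] (x : Ext (ModuleCat.of R M) (ModuleCat.of R R) i), x = 0) →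
      ∀ i, rs.length < i → ∀ (M : Type u) [AddCommGroup M] [Module R M]
      [Module.Finite R M] (x : Ext (ModuleCat.of R M) (ModuleCat.of R R) i), x = 0 from
    H n (fun i hi M _ _ _ x => Ext.eq_zero_of_hasInjectiveDimensionLT x (n + 1) (by omega)) i hi M x
  intro j
  induction j with
  | zero => exact fun h => h
  | succ j ih =>
    intro h
    refine ih fun i hi M _ _ _ x => ?_
    have := nontrivial_quotient_ofList_smul_top hrs R
    obtain ⟨s, hs⟩ := exists_injective_residueField hp
      (fun r hr => mem_annihilator_quotient_ofList_smul_top R hr)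
    exact ext_eq_zero_of_residueField (N := ModuleCat.of R R) (d := rs.length + j)
      (fun i hi => ext_eq_zero_of_injective hs (ext_quotient_ofList_eq_zero hrs hR _ (by omega))
        (h (i + 1) (by omega) _)) M hi x

/-- If `R` is a retract of a canonical module, then `R` is Gorenstein. -/
theorem isGorenstein_of_retract {ω : Type u} [AddCommGroup ω] [Module R ω]
    (h : IsCanonicalModule R ω) {d : ℕ} (hd : ringKrullDim R = d) {e : ω} {φ : ω →ₗ[R] R}
    (he : φ e = 1) : IsGorenstein R := by
  refine ⟨d, hasInjectiveDimensionLE_of_ext_eq_zero d _ fun I =>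
    ext_eq_zero_of_residueField (d := d) (fun i hi x => ?_) _ (Nat.lt_succ_self d)⟩
  have h1 : ModuleCat.ofHom (LinearMap.toSpanSingleton R ω e) ≫ ModuleCat.ofHom φ =
      𝟙 (ModuleCat.of R R) := by
    ext
    simp [he]
  have h2 : (x.comp (Ext.mk₀ (ModuleCat.ofHom (LinearMap.toSpanSingleton R ω e)))
      (add_zero i)).comp (Ext.mk₀ (ModuleCat.ofHom φ)) (add_zero i) = x := by
    rw [Ext.comp_assoc_of_third_deg_zero, Ext.mk₀_comp_mk₀, h1, Ext.comp_mk₀_id]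
  rw [← h2, h.ext_eq_zero hd hi.ne' (x.comp _ _), Ext.zero_comp]

end Gorenstein
-- Comparison of R with ω, and free summands of syzygies.
section Equivalence
open RingTheory.Sequence

variable {R : Type u} [CommRing R] [IsLocalRing R]

/-- A module whose reduction modulo a regular sequence is isomorphic to that of `R` via the class
of `1` is free of rank one. -/
theorem nonempty_linearEquiv_of_quotient_bijective [IsNoetherianRing R] {rs : List R}
    (hrs : ∀ r ∈ rs, r ∈ maximalIdeal R)
    {ω : Type u} [AddCommGroup ω] [Module R ω] [Module.Finite R ω] (hω : IsWeaklyRegular ω rs)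
    (h : (R ⧸ Ideal.ofList rs • (⊤ : Submodule R R)) →ₗ[R]
      ω ⧸ Ideal.ofList rs • (⊤ : Submodule R ω)) (hbij : Function.Bijective h) :
    Nonempty (R ≃ₗ[R] ω) := by
  obtain ⟨w, hw⟩ := Submodule.Quotient.mk_surjective _ (h (Submodule.Quotient.mk 1))
  let φ : R →ₗ[R] ω := LinearMap.toSpanSingleton R ω w
  have hjac : Ideal.ofList rs ≤ Ideal.jacobson ⊥ :=
    (ofList_le_maximalIdeal hrs).trans (IsLocalRing.maximalIdeal_le_jacobson _)
  have hφ (r : R) : (Submodule.Quotient.mk (φ r) : ω ⧸ Ideal.ofList rs • (⊤ : Submodule R ω)) =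
      h (Submodule.Quotient.mk r) := by
    rw [LinearMap.toSpanSingleton_apply, Submodule.Quotient.mk_smul, hw, ← map_smul,
      ← Submodule.Quotient.mk_smul]
    exact congrArg (fun t => h (Submodule.Quotient.mk t)) (mul_one r)
  have hsurj : Function.Surjective φ := by
    rw [← LinearMap.range_eq_top, ← top_le_iff]
    refine Submodule.le_of_le_smul_of_le_jacobson_bot Module.Finite.fg_top hjac fun x _ => ?_
    obtain ⟨y, hy⟩ := hbij.2 (Submodule.Quotient.mk x)
    obtain ⟨r, rfl⟩ := Submodule.Quotient.mk_surjective _ y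
    rw [← hφ, eq_comm, Submodule.Quotient.eq] at hy
    rw [← sub_add_cancel x (φ r), add_comm]
    exact Submodule.add_mem_sup ⟨r, rfl⟩ hy
  -- An element of the kernel lies in rs R by injectivity of `h`, hence in rs times the kernel by
  -- regularity on ω; Nakayama applies.
  have hker : LinearMap.ker φ = ⊥ := by
    rw [← Submodule.subsingleton_iff_eq_bot]
    have htop : (⊤ : Submodule R (LinearMap.ker φ)) ≤ Ideal.ofList rs • ⊤ := by
      rintro c -
      refine mem_ofList_smul_top_of_exact (LinearMap.ker φ).injective_subtype
        (LinearMap.exact_subtype_ker_map φ) hsurj hω ?_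
      rw [← Submodule.Quotient.mk_eq_zero]
      refine hbij.1 ?_
      rw [Submodule.subtype_apply, ← hφ, LinearMap.mem_ker.mp c.2, Submodule.Quotient.mk_zero,
        map_zero]
    have := Submodule.eq_bot_of_le_smul_of_le_jacobson_bot _ _ Module.Finite.fg_top htop hjac
    exact (Submodule.subsingleton_iff R).mp (subsingleton_of_bot_eq_top this.symm)
  exact ⟨LinearEquiv.ofBijective φ ⟨LinearMap.ker_eq_bot.mp hker, hsurj⟩⟩

/-- Over a local ring, a nonzero direct summand of a nontrivial quotient ring is everything. -/
theorem bijective_of_comp_eq_id {I : Submodule R R} {W : Type u}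
    [AddCommGroup W] [Module R W] [Nontrivial W] {g : W →ₗ[R] R ⧸ I} {h : (R ⧸ I) →ₗ[R] W}
    (hgh : h ∘ₗ g = LinearMap.id) : Function.Bijective h := by
  have hgh' (w : W) : h (g w) = w := LinearMap.congr_fun hgh w
  refine ⟨?_, fun w => ⟨g w, hgh' w⟩⟩
  obtain ⟨a, ha⟩ := Submodule.Quotient.mk_surjective _ (g (h (Submodule.Quotient.mk 1)))
  -- An endomorphism of the cyclic module R/I is multiplication by a scalar. Here 1 - a kills W ≠ 0,
  -- so a is a unit.
  have key (y : R ⧸ I) : g (h y) = a • y := by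
    obtain ⟨r, rfl⟩ := Submodule.Quotient.mk_surjective _ y
    have mk_eq (x : R) : (Submodule.Quotient.mk x : R ⧸ I) = x • Submodule.Quotient.mk 1 := by
      rw [← Submodule.Quotient.mk_smul]
      exact congrArg Submodule.Quotient.mk (mul_one x).symm
    rw [mk_eq r, map_smul, map_smul, ← ha, mk_eq a, smul_comm]
  have hW (w : W) : (1 - a) • w = 0 := by
    have h1 : h (a • g w) = w := by rw [← key, hgh', hgh']
    rw [map_smul, hgh'] at h1
    rw [sub_smul, one_smul, h1, sub_self]
  have hu : IsUnit a := by
    rcases IsLocalRing.isUnit_or_isUnit_one_sub_self a with h1 | h1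
    · exact h1
    · obtain ⟨w, hw⟩ := exists_ne (0 : W)
      exact absurd ((h1.smul_eq_zero).mp (hW w)) hw
  intro y z hyz
  have := congrArg g hyz
  rw [key, key] at this
  exact hu.smul_left_cancel.mp this

theorem hasNonzeroFreeSummand_of_linearEquiv {N : Type u} [AddCommGroup N] [Module R N]
    (e : R ≃ₗ[R] N) : HasNonzeroFreeSummand R N := by
  have : Nontrivial N := e.symm.toEquiv.nontrivial
  have : Module.Free R N := Module.Free.of_equiv e
  exact ⟨⊤, ⊥, isCompl_top_bot, top_ne_bot, Module.Free.of_equiv (Submodule.topEquiv (R := R)).symm⟩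

/-- A submodule `L` of `𝔪 F`, for `F` free, has no nonzero free summand if a maximal regular
sequence of `R` is regular on `F / L`. -/
theorem not_hasNonzeroFreeSummand_of_le_smul_top [IsNoetherianRing R] {rs : List R}
    (hrs : ∀ r ∈ rs, r ∈ maximalIdeal R)
    (hp : ∀ p : Ideal R, p.IsPrime → Ideal.ofList rs ≤ p → p = maximalIdeal R)
    {P N : Type u} [AddCommGroup P] [Module R P] [AddCommGroup N] [Module R N] {L : Submodule R P}
    {g : P →ₗ[R] N} (hg : Function.Surjective g) (hL : Function.Exact L.subtype g)
    (hm : L ≤ maximalIdeal R • ⊤) (hN : IsWeaklyRegular N rs) : ¬ HasNonzeroFreeSummand R L := by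
  intro hfree
  obtain ⟨e, φ, he⟩ := exists_apply_eq_one_of_hasNonzeroFreeSummand hfree
  have := nontrivial_quotient_ofList_smul_top hrs R
  obtain ⟨s, hs⟩ := exists_injective_residueField hp
    (fun r hr => mem_annihilator_quotient_ofList_smul_top R hr)
  -- `t` represents a nonzero socle element of R/rs: t𝔪 ⊆ (rs) but t ∉ (rs).
  obtain ⟨t, ht⟩ := Submodule.Quotient.mk_surjective _ (s 1)
  have htm : ∀ r ∈ maximalIdeal R, r * t ∈ Ideal.ofList rs := by
    intro r hr
    have h0 : r • (1 : ResidueField R) = 0 := by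
      rw [Algebra.smul_def, mul_one]
      exact (residue_eq_zero_iff r).mpr hr
    have h1 : (Submodule.Quotient.mk (r • t) : R ⧸ Ideal.ofList rs • (⊤ : Submodule R R)) = 0 := by
      rw [Submodule.Quotient.mk_smul, ht, ← map_smul, h0, map_zero]
    rw [Submodule.Quotient.mk_eq_zero] at h1
    simpa using h1
  have htI : t ∉ Ideal.ofList rs := by
    intro h
    refine one_ne_zero (hs (?_ : s 1 = s 0))
    rw [← ht, map_zero, Submodule.Quotient.mk_eq_zero]
    simpa using h
  have hmul : ∀ y ∈ maximalIdeal R • (⊤ : Submodule R P),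
      t • y ∈ Ideal.ofList rs • (⊤ : Submodule R P) := by
    intro y hy
    induction hy using Submodule.smul_induction_on' with
    | smul r hr m hm =>
      rw [smul_smul, mul_comm]
      exact Submodule.smul_mem_smul (htm r hr) trivial
    | add x _ y _ hx hy =>
      rw [smul_add]
      exact add_mem hx hy
  -- Since e ∈ 𝔪P, the product te lies in rs P ∩ L = rs L; applying `φ` gives the contradiction t ∈
  -- (rs).
  have hte : t • e ∈ Ideal.ofList rs • (⊤ : Submodule R L) :=
    mem_ofList_smul_top_of_exact L.injective_subtype hL hg hN (hmul _ (hm e.2))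
  have hφ := Submodule.mem_map_of_mem (f := φ) hte
  have hφe : φ (t • e) = t := by
    rw [map_smul, he]
    exact mul_one t
  rw [Submodule.map_smul'', hφe] at hφ
  have htop : t ∈ Ideal.ofList rs • (⊤ : Submodule R R) := Submodule.smul_mono le_rfl le_top hφ
  rw [smul_eq_mul, Ideal.mul_top] at htop
  exact htI htop

namespace MinimalFreeResolution

variable {M : Type u} [AddCommGroup M] [Module R M] (F : MinimalFreeResolution R M)

theorem exists_surjective_syzygy (n : ℕ) :
    ∃ g : (Fin (F.rank n) → R) →ₗ[R] F.syzygy n, Function.Surjective g ∧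
      Function.Exact (LinearMap.range (F.d n)).subtype g := by
  cases n with
  | zero =>
    have h : Function.Exact (LinearMap.range (F.d 0)).subtype F.ε.rangeRestrict := by
      rw [LinearMap.exact_iff, LinearMap.ker_rangeRestrict, Submodule.range_subtype]
      exact LinearMap.exact_iff.mp F.exact_ε
    exact ⟨F.ε.rangeRestrict, LinearMap.surjective_rangeRestrict _, h⟩
  | succ n =>
    have h : Function.Exact (LinearMap.range (F.d (n + 1))).subtype (F.d n).rangeRestrict := by
      rw [LinearMap.exact_iff, LinearMap.ker_rangeRestrict, Submodule.range_subtype]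
      exact LinearMap.exact_iff.mp (F.exact_d n)
    exact ⟨(F.d n).rangeRestrict, LinearMap.surjective_rangeRestrict _, h⟩

/-- The augmentation identifies the zeroth syzygy module with the module itself. -/
noncomputable def syzygyZeroEquiv : F.syzygy 0 ≃ₗ[R] M :=
  (LinearEquiv.ofEq _ _ (LinearMap.range_eq_top.mpr F.surjective_ε)).trans Submodule.topEquiv

theorem isWeaklyRegular_syzygy {rs : List R} (hR : IsWeaklyRegular R rs)
    (hM : IsWeaklyRegular M rs) (n : ℕ) : IsWeaklyRegular (F.syzygy n) rs := by
  induction n with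
  | zero => exact (F.syzygyZeroEquiv.isWeaklyRegular_congr rs).mpr hM
  | succ n ih =>
    obtain ⟨g, hg, hex⟩ := F.exists_surjective_syzygy n
    exact isWeaklyRegular_of_exact _ g (LinearMap.range (F.d n)).injective_subtype hex hg
      (isWeaklyRegular_pi_fin hR _) ih

/-- Positive syzygies in a minimal resolution of a maximal Cohen-Macaulay module have no nonzero
free summand. -/
theorem not_hasNonzeroFreeSummand_syzygy_succ [IsNoetherianRing R] {rs : List R}
    (hrs : ∀ r ∈ rs, r ∈ maximalIdeal R) (hR : IsWeaklyRegular R rs)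
    (hp : ∀ p : Ideal R, p.IsPrime → Ideal.ofList rs ≤ p → p = maximalIdeal R)
    (hM : IsWeaklyRegular M rs) (n : ℕ) : ¬ HasNonzeroFreeSummand R (F.syzygy (n + 1)) := by
  obtain ⟨g, hg, hex⟩ := F.exists_surjective_syzygy n
  exact not_hasNonzeroFreeSummand_of_le_smul_top hrs hp hg hex (F.minimal n)
    (F.isWeaklyRegular_syzygy hR hM n)

end MinimalFreeResolution

variable [IsNoetherianRing R]

theorem nonempty_linearEquiv_of_isGorenstein (hG : IsGorenstein R) {ω : Type u} [AddCommGroup ω]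
    [Module R ω] (h : IsCanonicalModule R ω) {d : ℕ} (hd : ringKrullDim R = d) {rs : List R}
    (hl : rs.length = d) (hrs : ∀ r ∈ rs, r ∈ maximalIdeal R) (hR : IsWeaklyRegular R rs)
    (hω : IsWeaklyRegular ω rs) : Nonempty (R ≃ₗ[R] ω) := by
  have := h.finite
  have hp : ∀ p : Ideal R, p.IsPrime → Ideal.ofList rs ≤ p → p = maximalIdeal R := fun p _ hp =>
    eq_maximalIdeal_of_ofList_le (RingTheory.Sequence.IsRegular.of_isWeaklyRegular_of_mem_maximalIdeal _ hrs
      hR) (by rw [hd, hl]) hp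
  have hmem : ∀ r ∈ rs, r ∈ Ideal.ofList rs := fun r hr => Ideal.subset_span hr
  obtain ⟨j, hj, hsoc⟩ := h.exists_socle_generator hd hrs hl hω
  have := isSimpleModule_residueField (R := R)
  have hjinj := LinearMap.injective_of_ne_zero hj
  have := nontrivial_quotient_ofList_smul_top hrs R
  obtain ⟨s, hs⟩ := exists_injective_residueField hp
    (fun r hr => mem_annihilator_quotient_ofList_smul_top R hr)
  obtain ⟨g, hg⟩ := exists_extension_of_ext_eq_zero (N := ModuleCat.of R R) hR
    (fun r hr => mem_annihilator_quotient_ofList_smul_top ω (hmem r hr)) j hjinj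
    (hG.ext_eq_zero hR hrs hp _ (Nat.lt_succ_self _)) s
  -- A nonzero kernel would contain a copy of k, of which `j` is a multiple since the socle is
  -- simple; but `g ∘ j = s` is nonzero.
  have hginj : Function.Injective g := by
    rw [← LinearMap.ker_eq_bot]
    by_contra hne
    have := Submodule.nontrivial_iff_ne_bot.mpr hne
    obtain ⟨t, ht⟩ := exists_injective_residueField (N := LinearMap.ker g) hp
      (fun r hr => LinearMap.annihilator_le_of_injective _ (LinearMap.ker g).injective_subtype
        (mem_annihilator_quotient_ofList_smul_top ω hr))
    have ht0 : (LinearMap.ker g).subtype ∘ₗ t ≠ 0 := by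
      intro h0
      have : t 1 = t 0 := by
        rw [map_zero]
        exact Subtype.ext (LinearMap.congr_fun h0 1)
      exact one_ne_zero (ht this)
    obtain ⟨r, hr⟩ := hsoc _ ht0
    have h1 : s 1 = s 0 := by
      rw [← hg, map_zero, LinearMap.comp_apply, ← hr]
      simp
    exact one_ne_zero (hs h1)
  -- Extending the identity of ω/rs along `g` splits `g`, as Ext^{d+1}(-, ω) vanishes on finitely
  -- generated modules.
  obtain ⟨p, hgp⟩ := exists_extension_of_ext_eq_zero (N := ModuleCat.of R ω) hω
    (fun r hr => mem_annihilator_quotient_ofList_smul_top R (hmem r hr)) g hginj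
    (ext_eq_zero_of_residueField (N := ModuleCat.of R ω) (d := d)
      (fun i hi => h.ext_eq_zero hd hi.ne') _ (by omega)) LinearMap.id
  have : Nontrivial (ω ⧸ Ideal.ofList rs • (⊤ : Submodule R ω)) := hjinj.nontrivial
  refine nonempty_linearEquiv_of_quotient_bijective hrs hω p (bijective_of_comp_eq_id hgp)

/-- Ext(k, -) vanishes below d on R by Cohen-Macaulayness and on ω by definition. A new sequence is
chosen for both at once, so `xs` need not be shown regular on ω. -/
theorem IsCanonicalModule.exists_isWeaklyRegular (hR : IsCohenMacaulay R) {ω : Type u}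
    [AddCommGroup ω] [Module R ω] (h : IsCanonicalModule R ω) :
    ∃ (d : ℕ) (rs : List R), ringKrullDim R = d ∧ rs.length = d ∧
      (∀ r ∈ rs, r ∈ maximalIdeal R) ∧ IsWeaklyRegular R rs ∧ IsWeaklyRegular ω rs := by
  obtain ⟨d, xs, hd, hl, hxs, hreg⟩ := exists_ringKrullDim_eq_and_isRegular hR
  have := h.finite
  obtain ⟨rs, h1, h2, h3, h4⟩ := exists_isWeaklyRegular_of_ext_eq_zero d (ModuleCat.of R R)
    (ModuleCat.of R ω)
    (fun i hi => ext_eq_zero_of_isWeaklyRegular (rs := xs) (fun r hr => by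
      rw [show Module.annihilator R (ResidueField R) = maximalIdeal R from
        Ideal.annihilator_quotient]
      exact hxs r hr) hreg.1 (hl ▸ hi))
    (fun i hi => h.ext_eq_zero hd hi.ne)
  exact ⟨d, rs, hd, h1, h2, h3, h4⟩

end Equivalence
end LocalAlgebra

theorem corollary3p6 (R : Type u) [CommRing R] [IsLocalRing R] [IsNoetherianRing R]
    (hR : LocalAlgebra.IsCohenMacaulay R) (ω : Type u) [AddCommGroup ω] [Module R ω]
    (hω : LocalAlgebra.IsCanonicalModule R ω) (F : LocalAlgebra.MinimalFreeResolution R ω) :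
    LocalAlgebra.IsGorenstein R ↔
      ∃ n : ℕ, LocalAlgebra.HasNonzeroFreeSummand R (F.syzygy n) := by
  obtain ⟨d, rs, hd, hl, hrs, hRreg, hωreg⟩ := hω.exists_isWeaklyRegular hR
  constructor
  · intro hG
    obtain ⟨e⟩ := LocalAlgebra.nonempty_linearEquiv_of_isGorenstein hG hω hd hl hrs hRreg hωreg
    exact ⟨0, LocalAlgebra.hasNonzeroFreeSummand_of_linearEquiv (e.trans F.syzygyZeroEquiv.symm)⟩
  · rintro ⟨n, hn⟩
    cases n with
    | zero =>
      obtain ⟨e, φ, he⟩ := LocalAlgebra.exists_apply_eq_one_of_hasNonzeroFreeSummand hn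
      exact LocalAlgebra.isGorenstein_of_retract hω hd (e := F.syzygyZeroEquiv e)
        (φ := φ ∘ₗ F.syzygyZeroEquiv.symm.toLinearMap) (by simpa using he)
    | succ n =>
      refine absurd hn (F.not_hasNonzeroFreeSummand_syzygy_succ hrs hRreg (fun p _ hp => ?_)
        hωreg n)
      exact LocalAlgebra.eq_maximalIdeal_of_ofList_le
        (RingTheory.Sequence.IsRegular.of_isWeaklyRegular_of_mem_maximalIdeal _ hrs hRreg)
        (by rw [hd, hl]) hp
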